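/- For a positive integer $B$, convex functions $f,g_1,\dots,g_m:\mathbb R^2\to\mathbb R$ and $S:=\{y\in\mathbb R^2: g_i(y)\le 0 \text{ for } i=1,\dots,m\}$, let $$\hat f^*:=\min\{f(\hat y):\hat y\in S\cap[-B,B]^2\cap\mathbb Z^2\},$$ with $\hat f^*:=+\infty$ if $S\cap[-B,B]^2\cap\mathbb Z^2=\emptyset$. There are a univariate real polynomial $p$ and a deterministic procedure with the following property. The input of the procedure is $m\ge 0$, $B\ge 1$ and a point $x\in\mathbb R^2$; it has access to $f,g_1,\dots,g_m$ only through their values at points of $\mathbb R^2$, which it may choose adaptively (other computations are not counted). Whenever $f,g_1,\dots,g_m$ are convex, $x\in[-B,B]^2$, $g_i(x)\le 0$ for all $i=1,\dots,m$, and $f(x)\le\hat f^*$, the procedure evaluates $f,g_1,\dots,g_m$ at no more than $p(\ln B)$ points, and then either (a) finds an $\hat x\in[-B,B]^2\cap\mathbb Z^2$ with $f(\hat x)=\hat f^*$ and $g_i(\hat x)\le 0$ for all $i=1,\dots,m$, or (b) reports, correctly, that there is no such point. The polynomial $p$ does not depend on $m$, $B$, $x$, $f$ or the $g_i$. -/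

import Mathlib

/-- A deterministic adaptive procedure which learns about `f, g₁, …, g_m : ℝ² → ℝ` only through
their values. Each `query p` evaluates each of the `m + 1` functions once at the point `p`; the rest
of the procedure may depend on the values `f p` and `(g₁ p, …, g_m p)` that are returned. The
procedure ends by reporting an integer point (`some z`) or that there is none (`none`). -/
inductive EvalProc (m : ℕ) : Type
  | output (r : Option (Fin 2 → ℤ)) : EvalProc m
  | query (p : Fin 2 → ℝ) (next : ℝ → (Fin m → ℝ) → EvalProc m) : EvalProc m

/-- The final report of the procedure, when it is run on the functions `f` and `g`. -/
def EvalProc.result {m : ℕ} (f : (Fin 2 → ℝ) → ℝ) (g : Fin m → (Fin 2 → ℝ) → ℝ) :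
    EvalProc m → Option (Fin 2 → ℤ)
  | .output r => r
  | .query p next => EvalProc.result f g (next (f p) (fun i => g i p))

/-- The number of points at which the procedure evaluates `f, g₁, …, g_m`, when it is run on
the functions `f` and `g`. -/
def EvalProc.numEvals {m : ℕ} (f : (Fin 2 → ℝ) → ℝ) (g : Fin m → (Fin 2 → ℝ) → ℝ) :
    EvalProc m → ℕ
  | .output _ => 0
  | .query p next => EvalProc.numEvals f g (next (f p) (fun i => g i p)) + 1

/-- An integer point of the plane as a real point. -/
def intPoint (z : Fin 2 → ℤ) : Fin 2 → ℝ := fun i => (z i : ℝ)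

/-- The box `[-B, B]²`. -/
def box (B : ℕ) : Set (Fin 2 → ℝ) := {x | ∀ i, x i ∈ Set.Icc (-(B : ℝ)) (B : ℝ)}

/-- The set `S` of the points at which all constraints `g i ≤ 0` hold. -/
def feasibleSet {m : ℕ} (g : Fin m → (Fin 2 → ℝ) → ℝ) : Set (Fin 2 → ℝ) :=
  {x | ∀ i, g i x ≤ 0}

/-- The integer points of `S ∩ [-B, B]²`. -/
def feasibleInt {m : ℕ} (g : Fin m → (Fin 2 → ℝ) → ℝ) (B : ℕ) : Set (Fin 2 → ℤ) :=
  {z | intPoint z ∈ feasibleSet g ∩ box B}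

/-- The optimal value of `f` over `S ∩ [-B, B]² ∩ ℤ²`; it is `+∞` if there is no such point. -/
noncomputable def optValue {m : ℕ} (f : (Fin 2 → ℝ) → ℝ) (g : Fin m → (Fin 2 → ℝ) → ℝ)
    (B : ℕ) : EReal :=
  ⨅ z ∈ feasibleInt g B, ((f (intPoint z) : ℝ) : EReal)

/-! The procedure is a cutting-plane method on a finite set `C` of candidate lattice points,
initially all of those in the box. It queries a deep point `c` of `C`, one for which every closed
half-plane with `c` on its boundary holds at least a quarter of `C`. If some `g i` is positive at
`c`, then `g i x ≤ 0 < g i c`; otherwise `c` is feasible and `f x ≤ f c`. Either way a convex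
function `h` with `h x ≤ h c` is known, and it suffices to find a half-plane through `c` on whose
candidates `h` is at least `h c`: these are infeasible or no better than `c`, so a quarter of `C`
goes.

Deep points exist by a Helly-type argument with four parity classes (`exists_cover_card_le_four`,
`exists_deep_latticePoint`); it needs only closure under lattice midpoints, which survives every
cut.

The half-plane is found without subgradients. For a line through `c`, one query at a point very near
`c` shows on which side of the ray from `x` through `c` the candidates beyond the line can go
(`exists_query_deciding_side`). Only finitely many slopes matter, so bisection takes `O(log |C|)`
queries (`Solvable.of_halfPlanes`). With `O(log |C|)` rounds and `|C| = (2B + 1) ^ 2`, the total is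
quadratic in `log B`. -/

/-! ### Deep lattice points -/

/-- A set of lattice points that contains every lattice point which is the midpoint of two of its
members. -/
def MidpointClosed (C : Finset (Fin 2 → ℤ)) : Prop :=
  ∀ z ∈ C, ∀ w ∈ C, ∀ p : Fin 2 → ℤ, (∀ i, z i + w i = 2 * p i) → p ∈ C

/-- The value at a lattice point of the linear functional with coefficients `a`. -/
def latticeEval (a : Fin 2 → ℝ) (z : Fin 2 → ℤ) : ℝ := a 0 * z 0 + a 1 * z 1

theorem latticeEval_midpoint (a : Fin 2 → ℝ) {z w p : Fin 2 → ℤ}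
    (h : ∀ i, z i + w i = 2 * p i) :
    latticeEval a z + latticeEval a w = 2 * latticeEval a p := by
  have h0 : (z 0 : ℝ) + w 0 = 2 * p 0 := by exact_mod_cast h 0
  have h1 : (z 1 : ℝ) + w 1 = 2 * p 1 := by exact_mod_cast h 1
  unfold latticeEval
  linear_combination a 0 * h0 + a 1 * h1

theorem exists_midpoint_of_same_parity {z w : Fin 2 → ℤ}
    (h : (fun i => (z i : ZMod 2)) = fun i => (w i : ZMod 2)) :
    ∃ p : Fin 2 → ℤ, ∀ i, z i + w i = 2 * p i := by
  have key : ∀ i, ∃ k : ℤ, z i + w i = 2 * k := fun i => by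
    have h1 := (ZMod.intCast_eq_intCast_iff_dvd_sub _ _ _).1 (congrFun h i)
    obtain ⟨k, hk⟩ := h1
    exact ⟨z i + k, by push_cast at hk; linarith⟩
  exact ⟨fun i => (key i).choose, fun i => (key i).choose_spec⟩

/-- The points of `C` in the closed half-plane `latticeEval a ≥ b`. -/
noncomputable def halfTrace (C : Finset (Fin 2 → ℤ)) (a : Fin 2 → ℝ) (b : ℝ) :
    Finset (Fin 2 → ℤ) :=
  C.filter fun z => b ≤ latticeEval a z

/-- If half-planes with a given property that passes to smaller half-planes cover a midpoint-closed
set of lattice points, then four of them cover it. -/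
theorem exists_cover_card_le_four {C : Finset (Fin 2 → ℤ)} (hC : MidpointClosed C)
    (bad : Finset (Fin 2 → ℤ) → Prop) (hbad : ∀ S T, S ⊆ T → bad T → bad S)
    (hcov : ∀ z ∈ C, ∃ a b, z ∈ halfTrace C a b ∧ bad (halfTrace C a b)) :
    ∃ F : Finset (Finset (Fin 2 → ℤ)), F.card ≤ 4 ∧ C ⊆ F.biUnion id ∧ ∀ S ∈ F, bad S := by
  classical
  let traces : Finset (Finset (Fin 2 → ℤ)) :=
    C.powerset.filter fun S => S.Nonempty ∧ bad S ∧ ∃ a b, S = halfTrace C a b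
  have htr : ∀ a b, (halfTrace C a b).Nonempty → bad (halfTrace C a b) →
      halfTrace C a b ∈ traces := fun a b h1 h2 =>
    Finset.mem_filter.2 ⟨Finset.mem_powerset.2 (Finset.filter_subset _ _), h1, h2, a, b, rfl⟩
  let covers := traces.powerset.filter fun F => C ⊆ F.biUnion id
  have hne : covers.Nonempty := by
    refine ⟨traces, Finset.mem_filter.2 ⟨Finset.mem_powerset_self _, fun z hz => ?_⟩⟩
    obtain ⟨a, b, h1, h2⟩ := hcov z hz
    exact Finset.mem_biUnion.2 ⟨_, htr a b ⟨z, h1⟩ h2, h1⟩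
  -- Minimising the total size, not the number of members, makes each half-plane tight as well as
  -- irredundant.
  obtain ⟨F, hF, hmin⟩ := Finset.exists_min_image covers (fun F => ∑ S ∈ F, S.card) hne
  obtain ⟨hFt, hFc⟩ := Finset.mem_filter.1 hF
  rw [Finset.mem_powerset] at hFt
  have hspec : ∀ S ∈ F, S.Nonempty ∧ bad S ∧ ∃ a b, S = halfTrace C a b := fun S hS =>
    (Finset.mem_filter.1 (hFt hS)).2
  refine ⟨F, ?_, hFc, fun S hS => (hspec S hS).2.1⟩
  -- each member of a minimal cover has a point of its own on its boundary line
  have hpriv : ∀ S ∈ F, ∃ p ∈ C, (∀ T ∈ F, T ≠ S → p ∉ T) ∧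
      ∃ a, S = halfTrace C a (latticeEval a p) := by
    intro S hS
    obtain ⟨hS1, hS2, a, b, hab⟩ := hspec S hS
    let own := S.filter fun p => ∀ T ∈ F, T ≠ S → p ∉ T
    have hown : own.Nonempty := by
      by_contra hemp
      have hcov' : F.erase S ∈ covers := by
        refine Finset.mem_filter.2 ⟨Finset.mem_powerset.2
          ((Finset.erase_subset _ _).trans hFt), fun z hz => ?_⟩
        obtain ⟨T, hT, hzT⟩ := Finset.mem_biUnion.1 (hFc hz)
        by_cases hTS : T = S
        · subst hTS
          by_contra hno
          refine hemp ⟨z, Finset.mem_filter.2 ⟨hzT, fun U hU hUT hzU => hno ?_⟩⟩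
          exact Finset.mem_biUnion.2 ⟨U, Finset.mem_erase.2 ⟨hUT, hU⟩, hzU⟩
        · exact Finset.mem_biUnion.2 ⟨T, Finset.mem_erase.2 ⟨hTS, hT⟩, hzT⟩
      have h1 := hmin _ hcov'
      have h2 := Finset.add_sum_erase F Finset.card hS
      have h3 := hS1.card_pos
      omega
    obtain ⟨p, hp, hpmin⟩ := Finset.exists_min_image own (latticeEval a) hown
    obtain ⟨hpS, hpo⟩ := Finset.mem_filter.1 hp
    have hpS' := hpS
    rw [hab] at hpS'
    obtain ⟨hpC, hpb⟩ := Finset.mem_filter.1 hpS'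
    refine ⟨p, hpC, hpo, a, ?_⟩
    let S' := halfTrace C a (latticeEval a p)
    have hsub : S' ⊆ S := by
      rw [hab]
      exact fun z hz => Finset.mem_filter.2
        ⟨(Finset.mem_filter.1 hz).1, hpb.trans (Finset.mem_filter.1 hz).2⟩
    -- Pushing the boundary of `S` in to its lowest private point `p` loses no private point, and
    -- all other points of `S` lie in other members. Minimality then gives `S' = S`.
    have hcov' : insert S' (F.erase S) ∈ covers := by
      refine Finset.mem_filter.2 ⟨Finset.mem_powerset.2 (Finset.insert_subset
        (htr _ _ ⟨p, Finset.mem_filter.2 ⟨hpC, le_rfl⟩⟩ (hbad _ _ hsub hS2))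
        ((Finset.erase_subset _ _).trans hFt)), fun z hz => ?_⟩
      by_cases hzo : z ∈ own
      · exact Finset.mem_biUnion.2 ⟨S', Finset.mem_insert_self _ _,
          Finset.mem_filter.2 ⟨hz, hpmin z hzo⟩⟩
      · obtain ⟨T, hT, hzT⟩ := Finset.mem_biUnion.1 (hFc hz)
        by_cases hTS : T = S
        · subst hTS
          have : ¬ ∀ U ∈ F, U ≠ T → z ∉ U := fun h => hzo (Finset.mem_filter.2 ⟨hzT, h⟩)
          push Not at this
          obtain ⟨U, hU, hUT, hzU⟩ := this
          exact Finset.mem_biUnion.2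
            ⟨U, Finset.mem_insert_of_mem (Finset.mem_erase.2 ⟨hUT, hU⟩), hzU⟩
        · exact Finset.mem_biUnion.2
            ⟨T, Finset.mem_insert_of_mem (Finset.mem_erase.2 ⟨hTS, hT⟩), hzT⟩
    have h1 := hmin _ hcov'
    have h2 := Finset.add_sum_erase F Finset.card hS
    have h3 : ∑ T ∈ insert S' (F.erase S), T.card ≤ S'.card + ∑ T ∈ F.erase S, T.card := by
      by_cases hin : S' ∈ F.erase S
      · rw [Finset.insert_eq_of_mem hin]; omega
      · rw [Finset.sum_insert hin]
    exact (Finset.eq_of_subset_of_card_le hsub (by omega)).symm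
  by_contra hcard
  push Not at hcard
  choose! P hPC hPo A hPA using hpriv
  -- Five private points cannot all differ modulo 2. The lattice midpoint of two congruent ones lies
  -- in some member `U`, whose boundary passes through its own private point. Every other private
  -- point is strictly outside `U`, so the midpoint is too.
  obtain ⟨S, hS, T, hT, hST, hpar⟩ := Finset.exists_ne_map_eq_of_card_lt_of_maps_to
    (s := F) (t := (Finset.univ : Finset (Fin 2 → ZMod 2))) (by simpa using hcard)
    (f := fun S i => (P S i : ZMod 2)) (fun _ _ => Finset.mem_coe.2 (Finset.mem_univ _))
  obtain ⟨p, hp⟩ := exists_midpoint_of_same_parity hpar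
  have hpC : p ∈ C := hC _ (hPC S hS) _ (hPC T hT) p hp
  obtain ⟨U, hU, hpU⟩ := Finset.mem_biUnion.1 (hFc hpC)
  simp only [id] at hpU
  rw [hPA U hU] at hpU
  have hUp := (Finset.mem_filter.1 hpU).2
  have hmid := latticeEval_midpoint (A U) hp
  have hout : ∀ V ∈ F, U ≠ V → latticeEval (A U) (P V) < latticeEval (A U) (P U) := by
    intro V hV hUV
    have := hPo V hV U hU hUV
    rw [hPA U hU] at this
    by_contra hle
    exact this (Finset.mem_filter.2 ⟨hPC V hV, not_lt.1 hle⟩)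
  by_cases h1 : U = S
  · subst h1
    have := hout T hT hST
    linarith
  · have h3 := hout S hS h1
    by_cases h2 : U = T
    · subst h2
      linarith
    · have := hout T hT h2
      linarith

/-- A centerpoint theorem for lattice points. -/
theorem exists_deep_latticePoint {C : Finset (Fin 2 → ℤ)} (hC : MidpointClosed C)
    (hne : C.Nonempty) :
    ∃ c ∈ C, ∀ a, C.card ≤ 4 * (halfTrace C a (latticeEval a c)).card := by
  classical
  by_contra hno
  push Not at hno
  -- Without a deep point, four sets of fewer than `C.card / 4` points each would cover `C`.
  obtain ⟨F, hF4, hFc, hFb⟩ := exists_cover_card_le_four hC (fun S => 4 * S.card < C.card)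
    (fun S T hST hT => by have := Finset.card_le_card hST; omega)
    (fun z hz => (hno z hz).imp fun a ha =>
      ⟨_, Finset.mem_filter.2 ⟨hz, le_rfl⟩, ha⟩)
  have h1 : C.card ≤ ∑ S ∈ F, S.card := (Finset.card_le_card hFc).trans Finset.card_biUnion_le
  have hFne : F.Nonempty := by
    obtain ⟨z, hz⟩ := hne
    obtain ⟨S, hS, -⟩ := Finset.mem_biUnion.1 (hFc hz)
    exact ⟨S, hS⟩
  have h2 : ∑ S ∈ F, 4 * S.card < ∑ _S ∈ F, C.card := Finset.sum_lt_sum_of_nonempty hFne hFb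
  rw [← Finset.mul_sum, Finset.sum_const, smul_eq_mul] at h2
  have h3 := Nat.mul_le_mul_right C.card hF4
  omega

/-! ### Convexity -/

/-- A convex function which at `p` is at least as large as at `x` and at `q` does not decrease on the
cone with apex `p` that points away from `x` and `q`. -/
theorem ConvexOn.le_of_mem_opposite_cone {h : (Fin 2 → ℝ) → ℝ} (hh : ConvexOn ℝ Set.univ h)
    {p q x z : Fin 2 → ℝ} {s r : ℝ} (hs : 0 ≤ s) (hr : 0 ≤ r)
    (hz : ∀ i, z i - p i = s * (p i - x i) + r * (p i - q i))
    (hx : h x ≤ h p) (hq : h q ≤ h p) : h p ≤ h z := by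
  have hpos : 0 < 1 + s + r := by linarith
  have hp : p = (1 / (1 + s + r)) • z + (s / (1 + s + r)) • x + (r / (1 + s + r)) • q := by
    funext i
    have := hz i
    simp only [Pi.add_apply, Pi.smul_apply, smul_eq_mul]
    field_simp
    linarith
  have hconv := hh.map_sum_le (t := Finset.univ)
    (w := ![1 / (1 + s + r), s / (1 + s + r), r / (1 + s + r)]) (p := ![z, x, q])
    (by intro i _; fin_cases i <;> simp <;> positivity)
    (by simp [Fin.sum_univ_three]; field_simp) (fun _ _ => Set.mem_univ _)
  simp only [Fin.sum_univ_three, Matrix.cons_val_zero, Matrix.cons_val_one, Matrix.cons_val,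
    smul_eq_mul] at hconv
  rw [← hp] at hconv
  have h1 := mul_le_mul_of_nonneg_left hconv hpos.le
  have h2 : (1 + s + r) * (1 / (1 + s + r) * h z + s / (1 + s + r) * h x + r / (1 + s + r) * h q)
      = h z + s * h x + r * h q := by field_simp
  rw [h2] at h1
  nlinarith [mul_le_mul_of_nonneg_left hx hs, mul_le_mul_of_nonneg_left hq hr]

/-- The coordinate of `z` along the direction from `x` to `c`, relative to `c`. -/
def alongCoord (x c z : Fin 2 → ℝ) : ℝ :=
  (z 0 - c 0) * (c 0 - x 0) + (z 1 - c 1) * (c 1 - x 1)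

/-- The coordinate of `z` across the direction from `x` to `c`, relative to `c`. -/
def acrossCoord (x c z : Fin 2 → ℝ) : ℝ :=
  (z 1 - c 1) * (c 0 - x 0) - (z 0 - c 0) * (c 1 - x 1)

/-- One query near `c` decides on which side of the ray from `x` through `c` the points of `C` beyond
the line of slope `t` can be discarded. -/
theorem exists_query_deciding_side {x c : Fin 2 → ℝ} (hxc : x ≠ c) (C : Finset (Fin 2 → ℤ))
    (t : ℝ) :
    ∃ q : Fin 2 → ℝ, ∀ h : (Fin 2 → ℝ) → ℝ, ConvexOn ℝ Set.univ h → h x ≤ h c →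
      (h q ≤ h c → ∀ z ∈ C, 0 ≤ acrossCoord x c (intPoint z) →
        t * acrossCoord x c (intPoint z) ≤ alongCoord x c (intPoint z) → h c ≤ h (intPoint z)) ∧
      (h c < h q → ∀ z ∈ C, acrossCoord x c (intPoint z) ≤ 0 →
        t * acrossCoord x c (intPoint z) ≤ alongCoord x c (intPoint z) →
          h c ≤ h (intPoint z)) := by
  set d : ℝ := (c 0 - x 0) ^ 2 + (c 1 - x 1) ^ 2 with hd
  have hdpos : 0 < d := by
    rcases lt_or_eq_of_le (show 0 ≤ d by positivity) with h | h
    · exact h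
    · exfalso
      apply hxc
      have h0 : c 0 - x 0 = 0 := by nlinarith [sq_nonneg (c 0 - x 0), sq_nonneg (c 1 - x 1)]
      have h1 : c 1 - x 1 = 0 := by nlinarith [sq_nonneg (c 0 - x 0), sq_nonneg (c 1 - x 1)]
      funext i
      fin_cases i
      · simp; linarith
      · simp; linarith
  -- This bound on `e` makes the coefficient `r` nonnegative when the apex of the cone is `q`
  -- instead of `c`. As `C` is finite, one `e` serves all its points, independently of `h`.
  have heps : ∃ e : ℝ, 0 < e ∧ ∀ z ∈ C, acrossCoord x c (intPoint z) < 0 →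
      e * (d + (alongCoord x c (intPoint z) - t * acrossCoord x c (intPoint z))) ≤
        -acrossCoord x c (intPoint z) := by
    have : ∀ᶠ e : ℝ in nhdsWithin 0 (Set.Ioi 0), ∀ z ∈ C, acrossCoord x c (intPoint z) < 0 →
        e * (d + (alongCoord x c (intPoint z) - t * acrossCoord x c (intPoint z))) ≤
          -acrossCoord x c (intPoint z) := by
      rw [Filter.eventually_all_finset]
      intro z _
      by_cases hz : acrossCoord x c (intPoint z) < 0
      · have hcont : Filter.Tendsto (fun e : ℝ => e * (d + (alongCoord x c (intPoint z) -
            t * acrossCoord x c (intPoint z)))) (nhdsWithin 0 (Set.Ioi 0)) (nhds 0) := by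
          have : Continuous (fun e : ℝ => e * (d + (alongCoord x c (intPoint z) -
            t * acrossCoord x c (intPoint z)))) := by fun_prop
          have h0 := this.tendsto 0
          rw [zero_mul] at h0
          exact h0.mono_left nhdsWithin_le_nhds
        filter_upwards [hcont.eventually (gt_mem_nhds (neg_pos.2 hz))] with e he _
        exact he.le
      · exact Filter.Eventually.of_forall fun e h => absurd h hz
    obtain ⟨e, he, he'⟩ := (this.and self_mem_nhdsWithin).exists
    exact ⟨e, he', he⟩
  obtain ⟨e, he, heC⟩ := heps
  -- With `u = c - x` and `u'` its rotation by a right angle, `q = c - e (u' + t u)` lies on the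
  -- line of slope `t`. If `h q ≤ h c`, the cone at `c` pointing away from `x` and `q` is used;
  -- otherwise the cone at `q` pointing away from `x` and `c`.
  refine ⟨![c 0 - e * (-(c 1 - x 1) + t * (c 0 - x 0)),
    c 1 - e * ((c 0 - x 0) + t * (c 1 - x 1))], fun h hh hx => ⟨?_, ?_⟩⟩
  · intro hq z _ hb ha
    refine hh.le_of_mem_opposite_cone (x := x)
      (s := (alongCoord x c (intPoint z) - t * acrossCoord x c (intPoint z)) / d)
      (r := acrossCoord x c (intPoint z) / (d * e))
      (div_nonneg (sub_nonneg.2 ha) hdpos.le) (by positivity) ?_ hx hq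
    intro i
    fin_cases i <;> simp [alongCoord, acrossCoord] <;> field_simp <;> rw [hd] <;> ring
  · intro hq z hz hb ha
    rcases lt_or_eq_of_le hb with hb | hb
    · refine hq.le.trans (hh.le_of_mem_opposite_cone (x := x) (q := c)
        (s := (alongCoord x c (intPoint z) - t * acrossCoord x c (intPoint z)) / d)
        (r := -acrossCoord x c (intPoint z) / (d * e) - 1 -
          (alongCoord x c (intPoint z) - t * acrossCoord x c (intPoint z)) / d)
        (div_nonneg (sub_nonneg.2 ha) hdpos.le) ?_ ?_ (hx.trans hq.le) hq.le)
      · have := heC z hz hb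
        have h2 : -acrossCoord x c (intPoint z) / (d * e) - 1 -
            (alongCoord x c (intPoint z) - t * acrossCoord x c (intPoint z)) / d =
            (-acrossCoord x c (intPoint z) - e * (d + (alongCoord x c (intPoint z) -
              t * acrossCoord x c (intPoint z)))) / (d * e) := by field_simp; ring
        rw [h2]
        exact div_nonneg (by linarith) (by positivity)
      · intro i
        fin_cases i <;> simp [alongCoord, acrossCoord] <;> field_simp <;> rw [hd] <;> ring
    · rw [hb, mul_zero] at ha
      refine hh.le_of_mem_opposite_cone (x := x) (q := c)
        (s := alongCoord x c (intPoint z) / d) (r := 0)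
        (div_nonneg ha hdpos.le) le_rfl ?_ hx le_rfl
      have hb' : (intPoint z 1 - c 1) * (c 0 - x 0) = (intPoint z 0 - c 0) * (c 1 - x 1) := by
        unfold acrossCoord at hb; linarith
      intro i
      fin_cases i
      · simp [alongCoord]; field_simp; rw [hd]; linear_combination (-(c 1 - x 1)) * hb'
      · simp [alongCoord]; field_simp; rw [hd]; linear_combination (c 0 - x 0) * hb'

/-! ### Procedures for classes of instances -/

/-- The objective and the constraints of an instance. -/
abbrev ConvexInstance (m : ℕ) : Type :=
  ((Fin 2 → ℝ) → ℝ) × (Fin m → (Fin 2 → ℝ) → ℝ)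

/-- The objective (index `none`) or one of the constraint functions of an instance. -/
def ConvexInstance.fn {m : ℕ} (F : ConvexInstance m) (j : Option (Fin m)) : (Fin 2 → ℝ) → ℝ :=
  j.elim F.1 F.2

/-- The report `r` is correct for the instance `F`. -/
def IsCorrectReport {m : ℕ} (B : ℕ) (F : ConvexInstance m) (r : Option (Fin 2 → ℤ)) : Prop :=
  (∀ z, r = some z →
    z ∈ feasibleInt F.2 B ∧ ((F.1 (intPoint z) : ℝ) : EReal) = optValue F.1 F.2 B) ∧
  (r = none → ¬ ∃ z ∈ feasibleInt F.2 B, ((F.1 (intPoint z) : ℝ) : EReal) = optValue F.1 F.2 B)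

/-- One procedure solves all instances in `V` with at most `N` evaluations. -/
def Solvable {m : ℕ} (B N : ℕ) (V : Set (ConvexInstance m)) : Prop :=
  ∃ A : EvalProc m, ∀ F ∈ V, A.numEvals F.1 F.2 ≤ N ∧ IsCorrectReport B F (A.result F.1 F.2)

theorem Solvable.of_output {m B N : ℕ} {V : Set (ConvexInstance m)} (r : Option (Fin 2 → ℤ))
    (h : ∀ F ∈ V, IsCorrectReport B F r) : Solvable B N V :=
  ⟨.output r, fun F hF => ⟨Nat.zero_le _, h F hF⟩⟩

theorem Solvable.mono {m B N : ℕ} {V W : Set (ConvexInstance m)} (h : Solvable B N W)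
    (hVW : V ⊆ W) : Solvable B N V :=
  h.imp fun _ hA F hF => hA F (hVW hF)

/-- The continuation may be chosen separately for each possible answer, so an adaptive procedure is
built by shrinking the class of instances consistent with the answers. -/
theorem Solvable.of_query {m B N : ℕ} {V : Set (ConvexInstance m)} (p : Fin 2 → ℝ)
    (h : ∀ (a : ℝ) (b : Fin m → ℝ), Solvable B N {F ∈ V | F.1 p = a ∧ ∀ i, F.2 i p = b i}) :
    Solvable B (N + 1) V := by
  choose A hA using h
  refine ⟨.query p A, fun F hF => ?_⟩
  have := hA (F.1 p) (fun i => F.2 i p) F ⟨hF, rfl, fun _ => rfl⟩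
  exact ⟨Nat.succ_le_succ this.1, this.2⟩

theorem exists_median (T : Finset ℝ) (hT : T.Nonempty) :
    ∃ t ∈ T, 2 * (T.filter (· < t)).card ≤ T.card ∧ 2 * (T.filter (t < ·)).card ≤ T.card := by
  let up := T.filter fun t => 2 * (T.filter (t < ·)).card ≤ T.card
  have hup : up.Nonempty := by
    refine ⟨T.max' hT, Finset.mem_filter.2 ⟨T.max'_mem hT, ?_⟩⟩
    rw [Finset.filter_eq_empty_iff.2 fun s hs => not_lt.2 (T.le_max' s hs)]
    simp
  obtain ⟨t, ht, hmin⟩ := Finset.exists_min_image up id hup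
  obtain ⟨htT, ht2⟩ := Finset.mem_filter.1 ht
  refine ⟨t, htT, ?_, ht2⟩
  -- `t` is the least element with at most half of `T` above it. If more than half were below `t`,
  -- the predecessor of `t` would also qualify.
  by_contra hlt
  have hne : (T.filter (· < t)).Nonempty := by
    rw [← Finset.card_pos]; omega
  obtain ⟨s, hs, hsmax⟩ := Finset.exists_max_image _ id hne
  obtain ⟨hsT, hst⟩ := Finset.mem_filter.1 hs
  have hsup : s ∈ up := by
    refine Finset.mem_filter.2 ⟨hsT, ?_⟩
    have hdisj : Disjoint (T.filter (· < t)) (T.filter (s < ·)) := by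
      refine Finset.disjoint_left.2 fun u hu hu' => ?_
      exact absurd (hsmax u hu) (not_le.2 (Finset.mem_filter.1 hu').2)
    have := Finset.card_le_card (Finset.union_subset (Finset.filter_subset (· < t) T)
      (Finset.filter_subset (s < ·) T))
    rw [Finset.card_union_of_disjoint hdisj] at this
    omega
  exact absurd (hmin s hsup) (not_le.2 hst)

/-- The convex function with index `j` is at least as large as at `c` at the points of `C` beyond
the line of slope `t` through `c`, on the side where the coordinate across is nonnegative. -/
def LeftCut {m : ℕ} (x c : Fin 2 → ℝ) (C : Finset (Fin 2 → ℤ)) (j : Option (Fin m)) (t : ℝ)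
    (F : ConvexInstance m) : Prop :=
  ∀ z ∈ C, 0 ≤ acrossCoord x c (intPoint z) →
    t * acrossCoord x c (intPoint z) ≤ alongCoord x c (intPoint z) → F.fn j c ≤ F.fn j (intPoint z)

/-- The counterpart of `LeftCut` where the coordinate across is nonpositive. -/
def RightCut {m : ℕ} (x c : Fin 2 → ℝ) (C : Finset (Fin 2 → ℤ)) (j : Option (Fin m)) (t : ℝ)
    (F : ConvexInstance m) : Prop :=
  ∀ z ∈ C, acrossCoord x c (intPoint z) ≤ 0 →
    t * acrossCoord x c (intPoint z) ≤ alongCoord x c (intPoint z) → F.fn j c ≤ F.fn j (intPoint z)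

/-- One bisection step: since `F.fn j c = v` is already known, the value at the single point `q`
settles which cut holds. -/
theorem Solvable.of_sides {m B N : ℕ} {V : Set (ConvexInstance m)} {x c : Fin 2 → ℝ} (hxc : x ≠ c)
    (C : Finset (Fin 2 → ℤ)) (j : Option (Fin m)) (t v : ℝ)
    (hV : ∀ F ∈ V, ConvexOn ℝ Set.univ (F.fn j) ∧ F.fn j x ≤ F.fn j c ∧ F.fn j c = v)
    (hl : Solvable B N {F ∈ V | LeftCut x c C j t F})
    (hr : Solvable B N {F ∈ V | RightCut x c C j t F}) : Solvable B (N + 1) V := by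
  obtain ⟨q, hq⟩ := exists_query_deciding_side hxc C t
  refine .of_query q fun a b => ?_
  have hval : ∀ F : ConvexInstance m, F.1 q = a → (∀ i, F.2 i q = b i) →
      F.fn j q = j.elim a b := by
    intro F h1 h2
    cases j with
    | none => exact h1
    | some i => exact h2 i
  by_cases hle : j.elim a b ≤ v
  · refine hl.mono fun F hF => ⟨hF.1, ?_⟩
    obtain ⟨h1, h2, h3⟩ := hV F hF.1
    exact (hq _ h1 h2).1 (by rw [hval F hF.2.1 hF.2.2, h3]; exact hle)
  · refine hr.mono fun F hF => ⟨hF.1, ?_⟩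
    obtain ⟨h1, h2, h3⟩ := hV F hF.1
    exact (hq _ h1 h2).2 (by rw [hval F hF.2.1 hF.2.2, h3]; exact not_le.1 hle)

/-- Bisection over the slopes of the lines through `c` and the other points of `C`. -/
theorem Solvable.of_halfPlanes_aux {m B N : ℕ} {x c : Fin 2 → ℝ} (hxc : x ≠ c)
    (C : Finset (Fin 2 → ℤ)) (j : Option (Fin m)) (v : ℝ) (L : ℕ) :
    ∀ (V : Set (ConvexInstance m)) (T : Finset ℝ) (lo hi : ℝ), lo < hi → T.card < 2 ^ L →
    (∀ t ∈ T, lo < t ∧ t < hi) →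
    (∀ z ∈ C, acrossCoord x c (intPoint z) ≠ 0 →
      lo < alongCoord x c (intPoint z) / acrossCoord x c (intPoint z) →
      alongCoord x c (intPoint z) / acrossCoord x c (intPoint z) < hi →
      alongCoord x c (intPoint z) / acrossCoord x c (intPoint z) ∈ T) →
    (∀ F ∈ V, ConvexOn ℝ Set.univ (F.fn j) ∧ F.fn j x ≤ F.fn j c ∧ F.fn j c = v) →
    (∀ F ∈ V, LeftCut x c C j hi F ∧ RightCut x c C j lo F) →
    (∀ t, Solvable B N {F ∈ V | ∀ z ∈ C, t * acrossCoord x c (intPoint z) ≤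
      alongCoord x c (intPoint z) → F.fn j c ≤ F.fn j (intPoint z)}) →
    Solvable B (N + L) V := by
  have hempty : ∀ (N : ℕ) (V : Set (ConvexInstance m)) (lo hi : ℝ), lo < hi →
      (∀ z ∈ C, acrossCoord x c (intPoint z) ≠ 0 →
        lo < alongCoord x c (intPoint z) / acrossCoord x c (intPoint z) →
        ¬ alongCoord x c (intPoint z) / acrossCoord x c (intPoint z) < hi) →
      (∀ F ∈ V, LeftCut x c C j hi F ∧ RightCut x c C j lo F) →
      (∀ t, Solvable B N {F ∈ V | ∀ z ∈ C, t * acrossCoord x c (intPoint z) ≤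
        alongCoord x c (intPoint z) → F.fn j c ≤ F.fn j (intPoint z)}) →
      Solvable B N V := by
    intro N V lo hi hlh hno hcut hsol
    -- No candidate has its slope strictly between `lo` and `hi`, so the half-plane of any
    -- intermediate slope holds only candidates covered by the two cuts.
    refine (hsol ((lo + hi) / 2)).mono fun F hF => ⟨hF, fun z hz hle => ?_⟩
    obtain ⟨hleft, hright⟩ := hcut F hF
    rcases lt_trichotomy (acrossCoord x c (intPoint z)) 0 with hb | hb | hb
    · refine hright z hz hb.le ?_
      have h1 : alongCoord x c (intPoint z) / acrossCoord x c (intPoint z) ≤ (lo + hi) / 2 :=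
        (div_le_iff_of_neg hb).2 hle
      have h2 : alongCoord x c (intPoint z) / acrossCoord x c (intPoint z) ≤ lo := by
        by_contra hlt
        exact hno z hz hb.ne (not_le.1 hlt) (by linarith)
      exact (div_le_iff_of_neg hb).1 h2
    · refine hright z hz hb.le ?_
      rw [hb] at hle ⊢
      simpa using hle
    · refine hleft z hz hb.le ?_
      have h1 : (lo + hi) / 2 ≤ alongCoord x c (intPoint z) / acrossCoord x c (intPoint z) :=
        (le_div_iff₀ hb).2 hle
      exact (le_div_iff₀ hb).1 (not_lt.1 (hno z hz hb.ne' (by linarith)))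
  induction L with
  | zero =>
    intro V T lo hi hlh hcard _ hcrit _ hcut hsol
    have hT : T = ∅ := by simpa using hcard
    exact hempty N V lo hi hlh (fun z hz h1 h2 h3 => by simpa [hT] using hcrit z hz h1 h2 h3)
      hcut hsol
  | succ L ih =>
    intro V T lo hi hlh hcard hTb hcrit hV hcut hsol
    rcases T.eq_empty_or_nonempty with hT | hT
    · obtain ⟨A, hA⟩ := hempty N V lo hi hlh
        (fun z hz h1 h2 h3 => by simpa [hT] using hcrit z hz h1 h2 h3) hcut hsol
      exact ⟨A, fun F hF => ⟨(hA F hF).1.trans (by omega), (hA F hF).2⟩⟩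
    obtain ⟨t, htT, ht1, ht2⟩ := exists_median T hT
    obtain ⟨hlt, hth⟩ := hTb t htT
    rw [pow_succ] at hcard
    refine .of_sides hxc C j t v hV ?_ ?_
    · refine ih _ (T.filter (· < t)) lo t hlt (by omega) (fun s hs => ?_) (fun z hz h1 h2 h3 => ?_)
        (fun F hF => hV F hF.1) (fun F hF => ⟨hF.2, (hcut F hF.1).2⟩)
        (fun s => (hsol s).mono fun F hF => ⟨hF.1.1, hF.2⟩)
      · obtain ⟨hs1, hs2⟩ := Finset.mem_filter.1 hs
        exact ⟨(hTb s hs1).1, hs2⟩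
      · exact Finset.mem_filter.2 ⟨hcrit z hz h1 h2 (h3.trans hth), h3⟩
    · refine ih _ (T.filter (t < ·)) t hi hth (by omega) (fun s hs => ?_) (fun z hz h1 h2 h3 => ?_)
        (fun F hF => hV F hF.1) (fun F hF => ⟨(hcut F hF.1).1, hF.2⟩)
        (fun s => (hsol s).mono fun F hF => ⟨hF.1.1, hF.2⟩)
      · obtain ⟨hs1, hs2⟩ := Finset.mem_filter.1 hs
        exact ⟨hs2, (hTb s hs1).2⟩
      · exact Finset.mem_filter.2 ⟨hcrit z hz h1 (hlt.trans h2) h3, h2⟩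

/-- It costs at most `L` evaluations to find a closed half-plane through `c` on whose points in `C`
the function with index `j` is at least as large as at `c`. -/
theorem Solvable.of_halfPlanes {m B N L : ℕ} {V : Set (ConvexInstance m)} {x c : Fin 2 → ℝ}
    (hxc : x ≠ c) (C : Finset (Fin 2 → ℤ)) (hL : C.card < 2 ^ L) (j : Option (Fin m)) (v : ℝ)
    (hV : ∀ F ∈ V, ConvexOn ℝ Set.univ (F.fn j) ∧ F.fn j x ≤ F.fn j c ∧ F.fn j c = v)
    (hsol : ∀ t, Solvable B N {F ∈ V | ∀ z ∈ C, t * acrossCoord x c (intPoint z) ≤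
      alongCoord x c (intPoint z) → F.fn j c ≤ F.fn j (intPoint z)}) :
    Solvable B (N + L) V := by
  classical
  let T : Finset ℝ :=
    C.image fun z => alongCoord x c (intPoint z) / acrossCoord x c (intPoint z)
  obtain ⟨M, hM⟩ : ∃ M : ℝ, ∀ t ∈ insert 0 T, |t| < M := by
    obtain ⟨M, hM⟩ := ((insert 0 T).image fun t => |t|).bddAbove
    exact ⟨M + 1, fun t ht => lt_of_le_of_lt
      (hM (Finset.mem_coe.2 (Finset.mem_image_of_mem _ ht))) (lt_add_one M)⟩
  have hM0 : 0 < M := by simpa using hM 0 (Finset.mem_insert_self _ _)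
  have hT : ∀ t ∈ T, -M < t ∧ t < M := fun t ht => abs_lt.1 (hM t (Finset.mem_insert_of_mem ht))
  -- Beyond the extreme slopes `-M` and `M` only candidates on the ray itself remain. No query is
  -- spent on them: either outcome of the comparison at `q` gives the claim.
  have hray : ∀ F ∈ V, ∀ z ∈ C, acrossCoord x c (intPoint z) = 0 →
      0 ≤ alongCoord x c (intPoint z) → F.fn j c ≤ F.fn j (intPoint z) := by
    intro F hF z hz hb ha
    obtain ⟨q, hq⟩ := exists_query_deciding_side hxc C 0
    obtain ⟨h1, h2, -⟩ := hV F hF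
    rcases le_or_gt (F.fn j q) (F.fn j c) with h | h
    · exact (hq _ h1 h2).1 h z hz hb.ge (by simpa using ha)
    · exact (hq _ h1 h2).2 h z hz hb.le (by simpa using ha)
  refine Solvable.of_halfPlanes_aux hxc C j v L V T (-M) M (by linarith)
    (Finset.card_image_le.trans_lt hL) hT
    (fun z hz _ _ _ => Finset.mem_image_of_mem _ hz) hV (fun F hF => ⟨?_, ?_⟩) hsol
  · intro z hz hb ha
    rcases lt_or_eq_of_le hb with hb | hb
    · exact absurd ((le_div_iff₀ hb).2 ha) (not_le.2 (hT _ (Finset.mem_image_of_mem _ hz)).2)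
    · exact hray F hF z hz hb.symm (by rw [← hb] at ha; simpa using ha)
  · intro z hz hb ha
    rcases lt_or_eq_of_le hb with hb | hb
    · exact absurd ((div_le_iff_of_neg hb).2 ha)
        (not_le.2 (hT _ (Finset.mem_image_of_mem _ hz)).1)
    · exact hray F hF z hz hb (by rw [hb] at ha; simpa using ha)

/-! ### The cutting procedure -/

/-- The hypotheses on an instance and the point `x`. -/
def IsAdmissible {m : ℕ} (B : ℕ) (x : Fin 2 → ℝ) (F : ConvexInstance m) : Prop :=
  (∀ j, ConvexOn ℝ Set.univ (F.fn j)) ∧ x ∈ feasibleSet F.2 ∧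
    ∀ z ∈ feasibleInt F.2 B, F.1 x ≤ F.1 (intPoint z)

/-- The point `r` (if any) is feasible, with objective value `M`, and no feasible point outside of `C`
is better. -/
def IsIncumbent {m : ℕ} (B : ℕ) (C : Finset (Fin 2 → ℤ)) (r : Option (Fin 2 → ℤ)) (M : EReal)
    (F : ConvexInstance m) : Prop :=
  (∀ z ∈ feasibleInt F.2 B, z ∈ C ∨ M ≤ (F.1 (intPoint z) : ℝ)) ∧ (r = none → M = ⊤) ∧
    ∀ b, r = some b → b ∈ feasibleInt F.2 B ∧ ((F.1 (intPoint b) : ℝ) : EReal) = M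

theorem IsIncumbent.isCorrectReport {m B : ℕ} {r : Option (Fin 2 → ℤ)} {M : EReal}
    {F : ConvexInstance m} (h : IsIncumbent B ∅ r M F) : IsCorrectReport B F r := by
  obtain ⟨h1, h2, h3⟩ := h
  have h1' : ∀ z ∈ feasibleInt F.2 B, M ≤ (F.1 (intPoint z) : ℝ) := fun z hz =>
    (h1 z hz).resolve_left (Finset.notMem_empty z)
  refine ⟨fun z hz => ⟨(h3 z hz).1, le_antisymm ?_ (iInf₂_le z (h3 z hz).1)⟩, fun hr => ?_⟩
  · rw [(h3 z hz).2]
    exact le_iInf₂ h1'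
  · rintro ⟨z, hz, -⟩
    have := h1' z hz
    rw [h2 hr, top_le_iff] at this
    exact EReal.coe_ne_top _ this

/-- Each of the `R` rounds costs one query at the deep point and `L` for the bisection, and keeps at
most three quarters of `C`. The bound `C.card * 3 ^ R < 4 ^ R` thus leaves `C` empty at the end. As
`x` is not integral, it never coincides with the deep point. -/
theorem solvable_of_isIncumbent {m B L : ℕ} {x : Fin 2 → ℝ} (hx : ∀ z, x ≠ intPoint z) (R : ℕ) :
    ∀ (C : Finset (Fin 2 → ℤ)) (r : Option (Fin 2 → ℤ)) (M : EReal), MidpointClosed C →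
      (∀ z ∈ C, intPoint z ∈ box B) → C.card < 2 ^ L → C.card * 3 ^ R < 4 ^ R →
      Solvable B (R * (L + 1)) {F : ConvexInstance m | IsAdmissible B x F ∧
        IsIncumbent B C r M F} := by
  induction R with
  | zero =>
    intro C r M _ _ _ hR
    have hC : C = ∅ := by simpa using hR
    subst hC
    exact .of_output r fun F hF => hF.2.isCorrectReport
  | succ R ih =>
    intro C r M hC hbox hL hR
    rcases C.eq_empty_or_nonempty with rfl | hne
    · exact .of_output r fun F hF => hF.2.isCorrectReport
    obtain ⟨c, hcC, hdeep⟩ := exists_deep_latticePoint hC hne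
    have hcut : ∀ t r' M', Solvable B (R * (L + 1)) {F : ConvexInstance m | IsAdmissible B x F ∧
        IsIncumbent B (C.filter fun z => ¬ t * acrossCoord x (intPoint c) (intPoint z) ≤
          alongCoord x (intPoint c) (intPoint z)) r' M' F} := by
      intro t r' M'
      -- The gradient of `alongCoord - t * acrossCoord`, which turns the cut into a half-plane with
      -- `c` on its boundary.
      let a : Fin 2 → ℝ := ![(c 0 - x 0) + t * (c 1 - x 1), (c 1 - x 1) - t * (c 0 - x 0)]
      have ha : ∀ z : Fin 2 → ℤ, t * acrossCoord x (intPoint c) (intPoint z) ≤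
          alongCoord x (intPoint c) (intPoint z) ↔ latticeEval a c ≤ latticeEval a z := by
        intro z
        rw [← sub_nonneg, ← sub_nonneg (a := latticeEval a z)]
        refine iff_of_eq (congrArg _ ?_)
        simp [latticeEval, a, acrossCoord, alongCoord, intPoint]
        ring
      have hcard : 4 * (C.filter fun z => ¬ t * acrossCoord x (intPoint c) (intPoint z) ≤
          alongCoord x (intPoint c) (intPoint z)).card ≤ 3 * C.card := by
        have h1 := hdeep a
        have h2 := Finset.card_filter_add_card_filter_not (s := C)
          (fun z => latticeEval a c ≤ latticeEval a z)
        simp only [ha]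
        unfold halfTrace at h1
        omega
      refine ih _ r' M' ?_ (fun z hz => hbox z (Finset.mem_filter.1 hz).1)
        ((Finset.card_filter_le _ _).trans_lt hL) ?_
      · intro z hz w hw p hp
        simp only [ha, Finset.mem_filter, not_le] at hz hw ⊢
        refine ⟨hC z hz.1 w hw.1 p hp, ?_⟩
        have := latticeEval_midpoint a hp
        linarith [hz.2, hw.2]
      · have h1 := Nat.mul_le_mul_right (3 ^ R) hcard
        rw [pow_succ, pow_succ] at hR
        nlinarith
    rw [Nat.succ_mul, ← Nat.add_assoc]
    refine .of_query (intPoint c) fun a b => ?_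
    by_cases hb : ∃ i, 0 < b i
    · obtain ⟨i, hi⟩ := hb
      refine .of_halfPlanes (hx c) C hL (some i) (b i) ?_ fun t => (hcut t r M).mono ?_
      · rintro F ⟨⟨hF, -⟩, -, hFb⟩
        exact ⟨hF.1 _, (hF.2.1 i).trans (by rw [← hFb i] at hi; exact hi.le), hFb i⟩
      · rintro F ⟨⟨⟨hF, hinc⟩, -, hFb⟩, hFt⟩
        refine ⟨hF, fun z hz => ?_, hinc.2⟩
        rcases hinc.1 z hz with hzC | hzM
        · refine Or.inl (Finset.mem_filter.2 ⟨hzC, fun hzt => ?_⟩)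
          have h1 : F.2 i (intPoint c) ≤ F.2 i (intPoint z) := hFt z hzC hzt
          have h2 := hz.1 i
          rw [hFb i] at h1
          linarith
        · exact Or.inr hzM
    · push Not at hb
      have hfeas : ∀ F : ConvexInstance m, (∀ i, F.2 i (intPoint c) = b i) →
          c ∈ feasibleInt F.2 B := fun F hF =>
        ⟨fun i => by rw [hF i]; exact hb i, hbox c hcC⟩
      refine .of_halfPlanes (hx c) C hL none a ?_ fun t => ?_
      · rintro F ⟨⟨hF, -⟩, hFa, hFb⟩
        exact ⟨hF.1 _, hF.2.2 c (hfeas F hFb), hFa⟩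
      have hz : ∀ M' : EReal, M' ≤ a → M' ≤ M → ∀ F : ConvexInstance m, IsIncumbent B C r M F →
          F.1 (intPoint c) = a →
          (∀ z ∈ C, t * acrossCoord x (intPoint c) (intPoint z) ≤
            alongCoord x (intPoint c) (intPoint z) → F.fn none (intPoint c) ≤
              F.fn none (intPoint z)) → ∀ z ∈ feasibleInt F.2 B,
          z ∈ (C.filter fun z => ¬ t * acrossCoord x (intPoint c) (intPoint z) ≤
            alongCoord x (intPoint c) (intPoint z)) ∨ M' ≤ (F.1 (intPoint z) : ℝ) := by
        intro M' h1 h2 F hinc hFa hFt z hz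
        rcases hinc.1 z hz with hzC | hzM
        · by_cases hzt : t * acrossCoord x (intPoint c) (intPoint z) ≤
              alongCoord x (intPoint c) (intPoint z)
          · have h3 : F.1 (intPoint c) ≤ F.1 (intPoint z) := hFt z hzC hzt
            rw [hFa] at h3
            exact Or.inr (h1.trans (EReal.coe_le_coe_iff.2 h3))
          · exact Or.inl (Finset.mem_filter.2 ⟨hzC, hzt⟩)
        · exact Or.inr (h2.trans hzM)
      rcases le_total M (a : EReal) with hMa | hMa
      · refine (hcut t r M).mono ?_
        rintro F ⟨⟨⟨hF, hinc⟩, hFa, hFb⟩, hFt⟩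
        exact ⟨hF, hz M hMa le_rfl F hinc hFa hFt, hinc.2⟩
      · refine (hcut t (some c) a).mono ?_
        rintro F ⟨⟨⟨hF, hinc⟩, hFa, hFb⟩, hFt⟩
        refine ⟨hF, hz a le_rfl hMa F hinc hFa hFt, by simp, fun p hp => ?_⟩
        obtain rfl := Option.some.inj hp
        exact ⟨hfeas F hFb, by rw [hFa]⟩

theorem isAdmissible_mk {m B : ℕ} {x : Fin 2 → ℝ} {f : (Fin 2 → ℝ) → ℝ}
    {g : Fin m → (Fin 2 → ℝ) → ℝ} (hf : ConvexOn ℝ Set.univ f)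
    (hg : ∀ i, ConvexOn ℝ Set.univ (g i)) (hx : x ∈ feasibleSet g)
    (hopt : ((f x : ℝ) : EReal) ≤ optValue f g B) :
    IsAdmissible B x ((f, g) : ConvexInstance m) := by
  refine ⟨fun j => ?_, hx, fun z hz => EReal.coe_le_coe_iff.1 (hopt.trans (iInf₂_le z hz))⟩
  cases j with
  | none => exact hf
  | some i => exact hg i

theorem solvable_isAdmissible {m B : ℕ} (hB : 1 ≤ B) {x : Fin 2 → ℝ} (hx : x ∈ box B) :
    Solvable B (3 * (2 * Nat.log 2 B + 6) * (2 * Nat.log 2 B + 7))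
      {F : ConvexInstance m | IsAdmissible B x F} := by
  by_cases hint : ∃ z, x = intPoint z
  -- An integral `x` is itself an optimal solution, and no query is needed.
  · obtain ⟨z, rfl⟩ := hint
    refine .of_output (some z) fun F hF => ⟨fun w hw => ?_, by simp⟩
    obtain rfl := Option.some.inj hw
    have hz : z ∈ feasibleInt F.2 B := ⟨hF.2.1, hx⟩
    exact ⟨hz, le_antisymm (le_iInf₂ fun w hw => EReal.coe_le_coe_iff.2 (hF.2.2 w hw))
      (iInf₂_le z hz)⟩
  push Not at hint
  let C : Finset (Fin 2 → ℤ) := Fintype.piFinset fun _ => Finset.Icc (-(B : ℤ)) B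
  have hmem : ∀ z, z ∈ C ↔ intPoint z ∈ box B := by
    intro z
    simp only [C, Fintype.mem_piFinset, Finset.mem_Icc, box, Set.mem_ofPred_eq, Set.mem_Icc,
      intPoint]
    exact forall_congr' fun i => by
      exact_mod_cast Iff.rfl
  have hcard : C.card < 2 ^ (2 * Nat.log 2 B + 6) := by
    have h1 : C.card = (2 * B + 1) * (2 * B + 1) := by
      have : ((B : ℤ) + 1 + B).toNat = 2 * B + 1 := by omega
      simp [C, Int.card_Icc, this, sq]
    have h2 : B < 2 ^ (Nat.log 2 B + 1) := Nat.lt_pow_succ_log_self one_lt_two B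
    have h3 : 2 ^ (2 * Nat.log 2 B + 6) = 16 * (2 ^ (Nat.log 2 B + 1) * 2 ^ (Nat.log 2 B + 1)) := by
      ring
    rw [h1, h3]
    nlinarith
  -- Three rounds more than halve `C`, as `2 * 3 ^ 3 ≤ 4 ^ 3`; hence three rounds per binary digit
  -- of the bound on `C.card`.
  refine (solvable_of_isIncumbent hint (3 * (2 * Nat.log 2 B + 6)) C none ⊤ ?_
    (fun z hz => (hmem z).1 hz) hcard ?_).mono fun F hF =>
      ⟨hF, fun z hz => Or.inl ((hmem z).2 hz.2), fun _ => rfl, by simp⟩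
  · intro z hz w hw p hp
    simp only [C, Fintype.mem_piFinset, Finset.mem_Icc] at hz hw ⊢
    intro i
    have h1 := hz i
    have h2 := hw i
    have h3 := hp i
    omega
  · rw [pow_mul, pow_mul]
    calc C.card * (3 ^ 3) ^ (2 * Nat.log 2 B + 6)
        < 2 ^ (2 * Nat.log 2 B + 6) * (3 ^ 3) ^ (2 * Nat.log 2 B + 6) :=
          Nat.mul_lt_mul_of_pos_right hcard (by positivity)
      _ = (2 * 3 ^ 3) ^ (2 * Nat.log 2 B + 6) := (mul_pow _ _ _).symm
      _ ≤ (4 ^ 3) ^ (2 * Nat.log 2 B + 6) := Nat.pow_le_pow_left (by norm_num) _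

/-- The factor 2 works because `log 2 > 1 / 2`. -/
theorem natLog_two_le_two_mul_log {B : ℕ} (hB : 1 ≤ B) :
    (Nat.log 2 B : ℝ) ≤ 2 * Real.log B := by
  have h1 : ((2 ^ Nat.log 2 B : ℕ) : ℝ) ≤ B := by
    exact_mod_cast Nat.pow_log_le_self 2 (by omega)
  have h2 := Real.log_le_log (by positivity) h1
  push_cast at h2
  rw [Real.log_pow] at h2
  have h3 := Real.log_two_gt_d9
  have h4 : (0 : ℝ) ≤ Nat.log 2 B := Nat.cast_nonneg _
  nlinarith

theorem mainTheorem9 :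
    ∃ (P : Polynomial ℝ) (A : (m B : ℕ) → (Fin 2 → ℝ) → EvalProc m),
      ∀ (m B : ℕ) (f : (Fin 2 → ℝ) → ℝ) (g : Fin m → (Fin 2 → ℝ) → ℝ) (x : Fin 2 → ℝ),
        1 ≤ B →
        ConvexOn ℝ Set.univ f →
        (∀ i, ConvexOn ℝ Set.univ (g i)) →
        x ∈ box B →
        x ∈ feasibleSet g →
        ((f x : ℝ) : EReal) ≤ optValue f g B →
          (((A m B x).numEvals f g : ℕ) : ℝ) ≤ P.eval (Real.log (B : ℝ)) ∧
          (∀ z : Fin 2 → ℤ, (A m B x).result f g = some z →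
            z ∈ feasibleInt g B ∧ ((f (intPoint z) : ℝ) : EReal) = optValue f g B) ∧
          ((A m B x).result f g = none →
            ¬ ∃ z ∈ feasibleInt g B, ((f (intPoint z) : ℝ) : EReal) = optValue f g B) := by
  have hsol : ∀ (m B : ℕ) (x : Fin 2 → ℝ), ∃ A : EvalProc m, 1 ≤ B → x ∈ box B →
      ∀ F : ConvexInstance m, IsAdmissible B x F →
        A.numEvals F.1 F.2 ≤ 3 * (2 * Nat.log 2 B + 6) * (2 * Nat.log 2 B + 7) ∧
          IsCorrectReport B F (A.result F.1 F.2) := by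
    intro m B x
    by_cases h : 1 ≤ B ∧ x ∈ box B
    · obtain ⟨A, hA⟩ := solvable_isAdmissible (m := m) h.1 h.2
      exact ⟨A, fun _ _ F hF => hA F hF⟩
    · exact ⟨.output none, fun h1 h2 => absurd ⟨h1, h2⟩ h⟩
  choose A hA using hsol
  -- The evaluation bound with `Nat.log 2 B` replaced by `2 * Real.log B`.
  refine ⟨Polynomial.C 3 * (Polynomial.C 4 * Polynomial.X + Polynomial.C 6) *
      (Polynomial.C 4 * Polynomial.X + Polynomial.C 7), A, ?_⟩
  intro m B f g x hB hf hg hxB hxg hopt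
  obtain ⟨hN, hr⟩ := hA m B x hB hxB (f, g) (isAdmissible_mk hf hg hxg hopt)
  refine ⟨?_, hr.1, hr.2⟩
  have h1 := natLog_two_le_two_mul_log hB
  have h2 : (0 : ℝ) ≤ Nat.log 2 B := Nat.cast_nonneg _
  refine (Nat.cast_le.2 hN).trans ?_
  push_cast
  simp only [Polynomial.eval_mul, Polynomial.eval_add, Polynomial.eval_C, Polynomial.eval_X]
  exact mul_le_mul (by linarith) (by linarith) (by linarith) (by linarith)
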